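/- There are $n$ voters and a set $\mathcal C=\{c_1,\dots,c_m\}$ of $m$ candidates; voter $v$ ranks the candidates by a bijection $r_v:\mathcal C\to\{1,\dots,m\}$ (rank $1$ is best). For a committee $T\subseteq\mathcal C$ with $|T|\ge s$ let $$r_{\mathcal V}(T)=\frac1n\sum_{v}\ \min_{Q\subseteq T,\ |Q|=s}\ \sum_{c\in Q}r_v(c)$$ be its $s$-Borda score, and let $\mathrm{Opt}=\min_{T\subseteq\mathcal C,\,|T|=k}r_{\mathcal V}(T)$. Consider the following randomized algorithm for choosing a committee of size $k$. 1. Solve the linear program: minimize $\sum_{i=1}^n\sum_{\ell=1}^s\sum_{j=1}^m x_{ij}^{\ell}\, r_{v_i}(c_j)$ subject to $\sum_j y_j=k$; $\ \sum_{\ell=1}^k x_{ij}^{\ell}\le y_j$ for all $i,j$; $\ \sum_j x_{ij}^{\ell}\ge 1$ for all $i$ and all $\ell\in\{1,\dots,k\}$; $\ y_j,x_{ij}^{\ell}\in[0,1]$. Let $\tilde y$ be the $y$-part of an optimal solution. 2. Let $y_j=(1-\frac1{\sqrt s})\,\tilde y_j$. 3. Apply dependent rounding to $y$: while two coordinates $y_i,y_j$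 ($i\ne j$) lie strictly between $0$ and $1$, pick such a pair (arbitrarily, possibly depending on the history), let $\alpha=\min(1-y_i,y_j)$ and $\beta=\min(y_i,1-y_j)$, and replace $(y_i,y_j)$ by $(y_i+\alpha,y_j-\alpha)$ with probability $\frac{\beta}{\alpha+\beta}$ and by $(y_i-\beta,y_j+\beta)$ with probability $\frac{\alpha}{\alpha+\beta}$; if a single fractional coordinate $y_i$ remains, round it to $1$ with probability $y_i$ and to $0$ otherwise. Let $T_1$ be the set of candidates whose coordinate ends at $1$; thus $|T_1|$ is $k(1-\frac1{\sqrt s})$ rounded up or down, and exactly this number when it is an integer. 4. Choose $T_2$ uniformly at random among the sets of $k-|T_1|$ candidates in $\mathcal C\setminus T_1$ (so $|T_2|=k/\sqrt s$ when this is an integer), and output $T=T_1\cup T_2$. **Theorem.** When $m=\omega(k)$, $k=\omega(s^{3/2})$ and $s=\omega(1)$, the algorithm can always be carried out, it always outputs a committee $T$ of size $k$, and $$\mathbb E[r_{\mathcal V}(T)]\ \le\ 3\,\mathrm{Opt}+O(s^{3/2}\log s)\cdot\frac{m+1}{k+1}.$$ That is, there are absolute constants $A,N>0$ such that for all $n$,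 all $s,k,m$ with $k\le m$, $s\ge N$, $k\ge N s^{3/2}$, $m\ge N k$, and all preference profiles, some execution of the algorithm exists, and every execution (whatever optimal LP solution and whatever pairs are picked) outputs a committee of size $k$ and satisfies $\mathbb E[r_{\mathcal V}(T)]\le 3\,\mathrm{Opt}+A\,s^{3/2}\log s\cdot\frac{m+1}{k+1}$. -/

import Mathlib

/-! Elections with `n` voters and `m` candidates, the `s`-Borda score, its LP relaxation,
dependent rounding, and the LP-rounding algorithm. -/

namespace SBorda

noncomputable section

/-- A preference profile: voter `v` ranks the candidates bijectively; `r v c` is the zero-based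
position of candidate `c` in the order of `v` (position `0` is the top). -/
abbrev Profile (n m : ℕ) : Type := Fin n → (Fin m ≃ Fin m)

/-- The rank `r_v(c) ∈ {1, …, m}`. -/
def rank {n m : ℕ} (r : Profile n m) (v : Fin n) (c : Fin m) : ℕ := (r v c : ℕ) + 1

/-- The cost of the committee `T` for voter `v`: the minimum over all `Q ⊆ T` with `|Q| = s` of
`∑_{c ∈ Q} r_v(c)`. It is a minimum over a finite set, which is non-empty as soon as `s ≤ |T|`. -/
def voterCost {n m : ℕ} (r : Profile n m) (s : ℕ) (v : Fin n) (T : Finset (Fin m)) : ℝ :=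
  ⨅ Q : {Q : Finset (Fin m) // Q ⊆ T ∧ Q.card = s}, ∑ c ∈ Q.1, (rank r v c : ℝ)

/-- The `s`-Borda score of the committee `T`: the average cost over all voters. -/
def score {n m : ℕ} (r : Profile n m) (s : ℕ) (T : Finset (Fin m)) : ℝ :=
  (1 / (n : ℝ)) * ∑ v, voterCost r s v T

/-- The minimum `s`-Borda score of a committee of size `k` (the minimum is over a finite set,
non-empty as soon as `k ≤ m`). -/
def opt {n m : ℕ} (r : Profile n m) (k s : ℕ) : ℝ :=
  ⨅ T : {T : Finset (Fin m) // T.card = k}, score r s T.1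

/-! ### The linear program -/

/-- Feasibility for the LP relaxation. `y j` is the extent to which candidate `j` is chosen and
`x i j l` the extent to which the `l`-th copy of voter `i` is assigned to candidate `j`. -/
structure LPFeasible {n m : ℕ} (k : ℕ) (y : Fin m → ℝ) (x : Fin n → Fin m → Fin k → ℝ) :
    Prop where
  sum_y : ∑ j, y j = k
  sum_x_le : ∀ i j, ∑ l, x i j l ≤ y j
  one_le_sum_x : ∀ i l, 1 ≤ ∑ j, x i j l
  y_mem : ∀ j, y j ∈ Set.Icc (0 : ℝ) 1
  x_mem : ∀ i j l, x i j l ∈ Set.Icc (0 : ℝ) 1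

/-- The objective `∑_i ∑_{l ≤ s} ∑_j x_{ij}^l r_{v_i}(c_j)`; only the first `s` of the `k` copies
of a voter are charged. -/
def lpObjective {n m : ℕ} (r : Profile n m) (k s : ℕ) (x : Fin n → Fin m → Fin k → ℝ) : ℝ :=
  ∑ i, ∑ l ∈ Finset.univ.filter (fun l : Fin k => (l : ℕ) < s), ∑ j, x i j l * (rank r i j : ℝ)

/-- `y` is the candidate part of an optimal solution of the LP. -/
def IsLPOptimal {n m : ℕ} (r : Profile n m) (k s : ℕ) (y : Fin m → ℝ) : Prop :=
  ∃ x : Fin n → Fin m → Fin k → ℝ, LPFeasible k y x ∧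
    ∀ (y' : Fin m → ℝ) (x' : Fin n → Fin m → Fin k → ℝ), LPFeasible k y' x' →
      lpObjective r k s x ≤ lpObjective r k s x'

/-! ### Dependent rounding -/

/-- `μ` is the law of: with probability `p` sample from `μ₁`, otherwise sample from `μ₂`. -/
def IsMixture {X : Type*} (p : ℝ) (μ₁ μ₂ μ : PMF X) : Prop :=
  ∀ a, (μ a).toReal = p * (μ₁ a).toReal + (1 - p) * (μ₂ a).toReal

/-- The vector obtained from `y` by adding `t` to coordinate `i` and subtracting it from `j`. -/
def shift {C : Type*} [DecidableEq C] (y : C → ℝ) (i j : C) (t : ℝ) : C → ℝ :=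
  Function.update (Function.update y i (y i + t)) j (y j - t)

/-- `DependentRounding y μ`: `μ` is the law of the random set produced by an execution of
dependent rounding on the vector `y`.

* If every coordinate is `0` or `1`, the procedure stops and outputs the coordinates equal to `1`.
* If two coordinates `i ≠ j` are fractional, pick such a pair (in any way depending on the current
  vector and the history). With `α = min (1 - y i) (y j)` and `β = min (y i) (1 - y j)`, replace
  `(y i, y j)` by `(y i + α, y j - α)` with probability `β / (α + β)` and by `(y i - β, y j + β)`
  with probability `α / (α + β)`, and continue.
* If exactly one coordinate `i` is fractional (possible only when `∑ j, y j` is not an integer),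
  round it to `1` with probability `y i` and to `0` with probability `1 - y i`. -/
inductive DependentRounding {C : Type*} [Fintype C] [DecidableEq C] :
    (C → ℝ) → PMF (Finset C) → Prop
  | done (y : C → ℝ) (T : Finset C) (hT : ∀ c, (c ∈ T ∧ y c = 1) ∨ (c ∉ T ∧ y c = 0)) :
      DependentRounding y (PMF.pure T)
  | pair (y : C → ℝ) (i j : C) (hij : i ≠ j)
      (hi : y i ∈ Set.Ioo (0 : ℝ) 1) (hj : y j ∈ Set.Ioo (0 : ℝ) 1) (α β : ℝ)
      (hα : α = min (1 - y i) (y j)) (hβ : β = min (y i) (1 - y j))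
      (μ₁ μ₂ μ : PMF (Finset C))
      (h₁ : DependentRounding (shift y i j α) μ₁)
      (h₂ : DependentRounding (shift y i j (-β)) μ₂)
      (hμ : IsMixture (β / (α + β)) μ₁ μ₂ μ) :
      DependentRounding y μ
  | last (y : C → ℝ) (i : C) (hi : y i ∈ Set.Ioo (0 : ℝ) 1)
      (hrest : ∀ j, j ≠ i → y j = 0 ∨ y j = 1)
      (μ₁ μ₂ μ : PMF (Finset C))
      (h₁ : DependentRounding (Function.update y i 1) μ₁)
      (h₂ : DependentRounding (Function.update y i 0) μ₂)
      (hμ : IsMixture (y i) μ₁ μ₂ μ) :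
      DependentRounding y μ

/-! ### The algorithm -/

theorem completions_nonempty {m k : ℕ} (hkm : k ≤ m) (T₁ : Finset (Fin m)) :
    ((T₁ᶜ).powersetCard (k - T₁.card)).Nonempty := by
  apply Finset.powersetCard_nonempty.2
  rw [Finset.card_compl, Fintype.card_fin]
  omega

/-- Complete `T₁` to a committee of size `k` by adding a uniformly random set of `k - |T₁|`
candidates outside `T₁`. -/
def completeUniformly {m k : ℕ} (hkm : k ≤ m) (T₁ : Finset (Fin m)) : PMF (Finset (Fin m)) :=
  (PMF.uniformOfFinset ((T₁ᶜ).powersetCard (k - T₁.card)) (completions_nonempty hkm T₁)).map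
    fun T₂ => T₁ ∪ T₂

/-- `μ` is the law of the committee output by an execution of the algorithm: take an optimal LP
solution `y`, scale it by `1 - 1 / √s`, apply dependent rounding to get `T₁`, and add uniformly
random candidates outside `T₁` up to size `k`. When `k / √s` is an integer, the scaled solution has
integral sum, `|T₁| = k (1 - 1 / √s)` and exactly `k / √s` random candidates are added. -/
def IsOutputLaw {n m k : ℕ} (r : Profile n m) (s : ℕ) (hkm : k ≤ m)
    (μ : PMF (Finset (Fin m))) : Prop :=
  ∃ (y : Fin m → ℝ) (ν : PMF (Finset (Fin m))),
    IsLPOptimal r k s y ∧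
    DependentRounding (fun j => (1 - 1 / √(s : ℝ)) * y j) ν ∧
    μ = ν.bind (completeUniformly hkm)

/-- The expected `s`-Borda score of a random committee with law `μ`. -/
def expectedScore {n m : ℕ} (r : Profile n m) (s : ℕ) (μ : PMF (Finset (Fin m))) : ℝ :=
  ∑ T, (μ T).toReal * score r s T

end

end SBorda

namespace SBorda

/-! Everything is decomposed by rank thresholds. A rank is the number of `t < m` for which the
candidate is not among the voter's top `t`, so a voter's cost for `T` is at most the sum over `t` of
the shortfall `(s - N_t)⁺`, where `N_t` counts the members of `T` in the top `t`
(`voterCost_le_sum_max`). The voter's share of the LP objective is at least the sum of `(s - F_t)⁺`,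
with `F_t` the fractional mass of the top `t` (`sum_max_le_voter_lp_cost`). It remains to compare
the two shortfalls for each `t`.

Let `a = 1/√s`. Dependent rounding and uniform completion both obey product bounds of
negative-correlation type, and together they bound `E exp(-a N_t)` (`mean_exp_neg_card_le`). The
rounding contributes a factor exponentially small in `F_t`; the random completion contributes `P_t =
(1 - bq)^t`, with `b = 1 - exp(-a)` and `q = ak/(2m)`.

From this, `mean_shortfall_le` gives `E (s - N_t)⁺ ≤ 3 (s - F_t)⁺ + 27 √s P_t`. If `F_t` is below `s
- √s`, the LP shortfall exceeds `√s` and pays for both the scaling loss and the fluctuations, whence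
the factor 3. Otherwise the error is `O(√s P_t)`, and the geometric series over `t` sums to `O(s
m/k)`. The resulting error `O(s^{3/2} m/k)` has no logarithm; the stated bound follows by weakening
it. -/

/-- The expectation of a real function under a probability mass function on a finite type. -/
noncomputable def mean {X : Type*} [Fintype X] (μ : PMF X) (f : X → ℝ) : ℝ :=
  ∑ a, (μ a).toReal * f a

theorem IsMixture.mem_support {X : Type*} {p : ℝ} {μ₁ μ₂ μ : PMF X}
    (h : IsMixture p μ₁ μ₂ μ) {a : X} (ha : a ∈ μ.support) : a ∈ μ₁.support ∨ a ∈ μ₂.support := by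
  by_contra! hn
  rw [PMF.mem_support_iff] at ha
  have := h a
  rw [(μ₁.apply_eq_zero_iff a).2 hn.1, (μ₂.apply_eq_zero_iff a).2 hn.2] at this
  simp [ENNReal.toReal_eq_zero_iff, ha, μ.apply_ne_top a] at this

/-! ### Expectations under laws on finite types. -/

section mean

variable {X Y : Type*} [Fintype X] [Fintype Y]

theorem sum_toReal_apply (μ : PMF X) : ∑ a, (μ a).toReal = 1 := by
  rw [← ENNReal.toReal_sum fun a _ => μ.apply_ne_top a, ← tsum_fintype (L := .unconditional _),
    μ.tsum_coe, ENNReal.toReal_one]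

theorem mean_mono {μ : PMF X} {f g : X → ℝ} (h : ∀ a ∈ μ.support, f a ≤ g a) :
    mean μ f ≤ mean μ g := by
  refine Finset.sum_le_sum fun a _ => ?_
  by_cases ha : a ∈ μ.support
  · exact mul_le_mul_of_nonneg_left (h a ha) ENNReal.toReal_nonneg
  · simp [(μ.apply_eq_zero_iff a).2 ha]

theorem mean_add (μ : PMF X) (f g : X → ℝ) :
    mean μ (fun a => f a + g a) = mean μ f + mean μ g := by
  simp [mean, mul_add, Finset.sum_add_distrib]

theorem mean_const_mul (μ : PMF X) (c : ℝ) (f : X → ℝ) :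
    mean μ (fun a => c * f a) = c * mean μ f := by
  simp [mean, Finset.mul_sum, mul_left_comm]

theorem mean_const (μ : PMF X) (c : ℝ) : mean μ (fun _ => c) = c := by
  simp [mean, ← Finset.sum_mul, sum_toReal_apply]

theorem mean_sum {ι : Type*} (μ : PMF X) (s : Finset ι) (f : ι → X → ℝ) :
    mean μ (fun a => ∑ i ∈ s, f i a) = ∑ i ∈ s, mean μ (f i) := by
  simp only [mean, Finset.mul_sum]
  exact Finset.sum_comm

theorem mean_bind (ν : PMF X) (κ : X → PMF Y) (f : Y → ℝ) :
    mean (ν.bind κ) f = mean ν fun a => mean (κ a) f := by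
  have h (b : Y) : ((ν.bind κ) b).toReal = ∑ a, (ν a).toReal * (κ a b).toReal := by
    rw [PMF.bind_apply, tsum_fintype, ENNReal.toReal_sum fun a _ =>
      ENNReal.mul_ne_top (ν.apply_ne_top a) ((κ a).apply_ne_top b)]
    simp
  simp only [mean, h, Finset.sum_mul, Finset.mul_sum]
  rw [Finset.sum_comm]
  simp [mul_assoc]

theorem mean_pure (a : X) (f : X → ℝ) : mean (PMF.pure a) f = f a := by
  classical
  rw [mean, Finset.sum_eq_single a] <;> simp +contextual [PMF.pure_apply]

theorem mean_map (μ : PMF X) (g : X → Y) (f : Y → ℝ) :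
    mean (μ.map g) f = mean μ fun a => f (g a) := by
  rw [PMF.map, mean_bind]
  simp [mean_pure]

theorem mean_uniformOfFinset (s : Finset X) (hs : s.Nonempty) (f : X → ℝ) :
    mean (PMF.uniformOfFinset s hs) f = (∑ a ∈ s, f a) / s.card := by
  classical
  rw [mean, Finset.sum_div, ← Finset.sum_filter_add_sum_filter_not Finset.univ (· ∈ s)]
  rw [Finset.sum_eq_zero (s := Finset.univ.filter fun a => a ∉ s), add_zero]
  · simp only [Finset.filter_univ_mem]
    refine Finset.sum_congr rfl fun a ha => ?_
    rw [PMF.uniformOfFinset_apply_of_mem hs ha, ENNReal.toReal_inv, ENNReal.toReal_natCast]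
    ring
  · intro a ha
    rw [PMF.uniformOfFinset_apply_of_notMem hs (Finset.mem_filter.1 ha).2]
    simp

theorem IsMixture.mean_eq {p : ℝ} {μ₁ μ₂ μ : PMF X} (h : IsMixture p μ₁ μ₂ μ) (f : X → ℝ) :
    mean μ f = p * mean μ₁ f + (1 - p) * mean μ₂ f := by
  simp only [mean, h _, Finset.mul_sum, ← Finset.sum_add_distrib]
  exact Finset.sum_congr rfl fun a _ => by ring

theorem exists_isMixture {p : ℝ} (hp : p ∈ Set.Icc (0 : ℝ) 1) (μ₁ μ₂ : PMF X) :
    ∃ μ, IsMixture p μ₁ μ₂ μ := by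
  have hp' : 0 ≤ 1 - p := by linarith [hp.2]
  refine ⟨PMF.ofFintype
    (fun a => ENNReal.ofReal (p * (μ₁ a).toReal + (1 - p) * (μ₂ a).toReal)) ?_, fun a => ?_⟩
  · rw [← ENNReal.ofReal_sum_of_nonneg]
    · rw [Finset.sum_add_distrib, ← Finset.mul_sum, ← Finset.mul_sum, sum_toReal_apply,
        sum_toReal_apply]
      simp
    · intro a _
      have := hp.1
      positivity
  · rw [PMF.ofFintype_apply, ENNReal.toReal_ofReal]
    have := hp.1
    positivity

end mean

theorem exists_int_sum_eq {C : Type*} [Fintype C] {y : C → ℝ} (hy : ∀ c, y c = 0 ∨ y c = 1) :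
    ∃ z : ℤ, ∑ c, y c = z := by
  refine ⟨∑ c, if y c = 1 then 1 else 0, ?_⟩
  push_cast
  refine Finset.sum_congr rfl fun c _ => ?_
  rcases hy c with h | h <;> simp [h]

/-! ### Dependent rounding: product bounds, cardinality, existence. -/

section rounding

variable {C : Type*} [DecidableEq C]

theorem shift_apply_left {y : C → ℝ} {i j : C} (hij : i ≠ j) (t : ℝ) :
    shift y i j t i = y i + t := by
  simp [shift, Function.update_of_ne hij]

theorem shift_apply_right (y : C → ℝ) (i j : C) (t : ℝ) : shift y i j t j = y j - t := by
  simp [shift]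

theorem shift_apply_of_ne {y : C → ℝ} {i j c : C} (hi : c ≠ i) (hj : c ≠ j) (t : ℝ) :
    shift y i j t c = y c := by
  simp [shift, hi, hj]

theorem prod_eq_ite_mul_ite_mul (f : C → ℝ) (S : Finset C) {i j : C} (hij : i ≠ j) :
    ∏ c ∈ S, f c = (if i ∈ S then f i else 1) * (if j ∈ S then f j else 1) *
      ∏ c ∈ (S.erase i).erase j, f c := by
  have h (U : Finset C) (d : C) :
      ∏ c ∈ U, f c = (if d ∈ U then f d else 1) * ∏ c ∈ U.erase d, f c := by
    split_ifs with hd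
    · rw [Finset.mul_prod_erase _ _ hd]
    · rw [Finset.erase_eq_of_notMem hd, one_mul]
  rw [h S i, h (S.erase i) j, mul_assoc]
  simp [Finset.mem_erase, hij.symm]

theorem shift_mem_Icc {y : C → ℝ} {i j : C} (hij : i ≠ j) (hy : ∀ c, y c ∈ Set.Icc (0 : ℝ) 1)
    {t : ℝ} (h₁ : -y i ≤ t) (h₂ : t ≤ 1 - y i) (h₃ : t ≤ y j) (h₄ : y j - 1 ≤ t) (c : C) :
    shift y i j t c ∈ Set.Icc (0 : ℝ) 1 := by
  by_cases hi : c = i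
  · subst hi
    rw [shift_apply_left hij]
    constructor <;> linarith
  by_cases hj : c = j
  · subst hj
    rw [shift_apply_right]
    constructor <;> linarith
  rw [shift_apply_of_ne hi hj]
  exact hy c

theorem shift_up_mem_Icc {y : C → ℝ} {i j : C} (hij : i ≠ j)
    (hy : ∀ c, y c ∈ Set.Icc (0 : ℝ) 1) (c : C) :
    shift y i j (min (1 - y i) (y j)) c ∈ Set.Icc (0 : ℝ) 1 := by
  have h0 : 0 ≤ min (1 - y i) (y j) := le_min (by linarith [(hy i).2]) (hy j).1
  exact shift_mem_Icc hij hy (by linarith [(hy i).1]) (min_le_left _ _) (min_le_right _ _)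
    (by linarith [(hy j).2]) c

theorem shift_down_mem_Icc {y : C → ℝ} {i j : C} (hij : i ≠ j)
    (hy : ∀ c, y c ∈ Set.Icc (0 : ℝ) 1) (c : C) :
    shift y i j (-min (y i) (1 - y j)) c ∈ Set.Icc (0 : ℝ) 1 := by
  have h0 : 0 ≤ min (y i) (1 - y j) := le_min (hy i).1 (by linarith [(hy j).2])
  have h1 := min_le_left (y i) (1 - y j)
  have h2 := min_le_right (y i) (1 - y j)
  exact shift_mem_Icc hij hy (by linarith) (by linarith [(hy i).2]) (by linarith [(hy j).1])
    (by linarith) c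

/-- A pair step preserves both means and moves the coordinates in opposite directions. If at most
one of `i, j` lies in `S`, the product is affine in the moved coordinate and its mean is unchanged;
if both do, it drops by `b²αβ` times the remaining factors. -/
theorem prod_shift_mixture_le {y : C → ℝ} {i j : C} (hij : i ≠ j) (S : Finset C) {b : ℝ}
    (hR : ∀ c, 0 ≤ 1 - b * y c) {α β : ℝ} (hα : 0 < α) (hβ : 0 < β) :
    β / (α + β) * ∏ c ∈ S, (1 - b * shift y i j α c) +
      (1 - β / (α + β)) * ∏ c ∈ S, (1 - b * shift y i j (-β) c) ≤ ∏ c ∈ S, (1 - b * y c) := by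
  have hshift (t : ℝ) : ∏ c ∈ (S.erase i).erase j, (1 - b * shift y i j t c) =
      ∏ c ∈ (S.erase i).erase j, (1 - b * y c) := by
    refine Finset.prod_congr rfl fun c hc => ?_
    simp only [Finset.mem_erase] at hc
    rw [shift_apply_of_ne hc.2.1 hc.1]
  have hq : 1 - β / (α + β) = α / (α + β) := by field_simp; ring
  rw [prod_eq_ite_mul_ite_mul _ S hij, prod_eq_ite_mul_ite_mul _ S hij,
    prod_eq_ite_mul_ite_mul (fun c => 1 - b * y c) S hij, hshift, hshift, hq]
  simp only [shift_apply_left hij, shift_apply_right]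
  have hR0 : 0 ≤ ∏ c ∈ (S.erase i).erase j, (1 - b * y c) := Finset.prod_nonneg fun c _ => hR c
  generalize ∏ c ∈ (S.erase i).erase j, (1 - b * y c) = R at hR0
  split_ifs
  · have : (1 - b * y i) * (1 - b * y j) * R -
        (β / (α + β) * ((1 - b * (y i + α)) * (1 - b * (y j - α)) * R) +
        α / (α + β) * ((1 - b * (y i + -β)) * (1 - b * (y j - -β)) * R)) =
        b ^ 2 * (α * β) * R := by field_simp; ring
    have : 0 ≤ b ^ 2 * (α * β) * R := by positivity
    linarith
  all_goals
    apply le_of_eq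
    field_simp
    ring

variable [Fintype C]

/-- The product is a supermartingale along the rounding. Taking `b = 1 - exp(-a)` turns the left
side into an exponential moment of `|S ∩ T|`. -/
theorem DependentRounding.mean_prod_le {y : C → ℝ} {μ : PMF (Finset C)}
    (h : DependentRounding y μ) (hy : ∀ c, y c ∈ Set.Icc (0 : ℝ) 1) (S : Finset C) {b : ℝ}
    (hb : b ∈ Set.Icc (0 : ℝ) 1) :
    mean μ (fun T => ∏ c ∈ S, if c ∈ T then 1 - b else 1) ≤ ∏ c ∈ S, (1 - b * y c) := by
  have hnn {z : C → ℝ} (hz : ∀ c, z c ∈ Set.Icc (0 : ℝ) 1) (c : C) : 0 ≤ 1 - b * z c := by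
    nlinarith [hb.1, hb.2, (hz c).1, (hz c).2]
  induction h with
  | done y T hT =>
    rw [mean_pure]
    refine le_of_eq (Finset.prod_congr rfl fun c _ => ?_)
    rcases hT c with ⟨h, h'⟩ | ⟨h, h'⟩ <;> simp [h, h']
  | pair y i j hij hi hj α β hα hβ μ₁ μ₂ μ h₁ h₂ hμ ih₁ ih₂ =>
    have hα0 : 0 < α := hα ▸ lt_min (by linarith [hi.2]) hj.1
    have hβ0 : 0 < β := hβ ▸ lt_min hi.1 (by linarith [hj.2])
    have h1 := ih₁ (hα ▸ shift_up_mem_Icc hij hy)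
    have h2 := ih₂ (hβ ▸ shift_down_mem_Icc hij hy)
    rw [hμ.mean_eq]
    refine le_trans (add_le_add (mul_le_mul_of_nonneg_left h1 (by positivity))
      (mul_le_mul_of_nonneg_left h2 ?_)) (prod_shift_mixture_le hij S (hnn hy) hα0 hβ0)
    rw [sub_nonneg, div_le_one (by positivity)]
    linarith
  | last y i hi hrest μ₁ μ₂ μ h₁ h₂ hμ ih₁ ih₂ =>
    have hupd {t : ℝ} (ht : t ∈ Set.Icc (0 : ℝ) 1) (c : C) :
        Function.update y i t c ∈ Set.Icc (0 : ℝ) 1 := by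
      rcases eq_or_ne c i with rfl | hc
      · simpa using ht
      · simpa [hc] using hy c
    have hprod (t : ℝ) : ∏ c ∈ S, (1 - b * Function.update y i t c) =
        (if i ∈ S then 1 - b * t else 1) * ∏ c ∈ S.erase i, (1 - b * y c) := by
      have hc : ∏ c ∈ S.erase i, (1 - b * Function.update y i t c) =
          ∏ c ∈ S.erase i, (1 - b * y c) :=
        Finset.prod_congr rfl fun c hc => by simp [Finset.ne_of_mem_erase hc]
      split_ifs with hiS
      · rw [← Finset.mul_prod_erase _ _ hiS, hc]
        simp
      · rw [← hc, Finset.erase_eq_of_notMem hiS, one_mul]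
    have h1 := ih₁ (hupd (by simp))
    have h2 := ih₂ (hupd (by simp))
    have h3 := hprod (y i)
    rw [Function.update_eq_self] at h3
    rw [hprod] at h1 h2
    rw [hμ.mean_eq, h3]
    refine le_trans (add_le_add (mul_le_mul_of_nonneg_left h1 hi.1.le)
      (mul_le_mul_of_nonneg_left h2 (by linarith [hi.2]))) (le_of_eq ?_)
    split_ifs <;> ring

theorem sum_shift (y : C → ℝ) {i j : C} (hij : i ≠ j) (t : ℝ) :
    ∑ c, shift y i j t c = ∑ c, y c := by
  rw [← sub_eq_zero, ← Finset.sum_sub_distrib, Finset.sum_eq_add i j hij]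
  · rw [shift_apply_left hij, shift_apply_right]; ring
  · intro c _ hc
    rw [shift_apply_of_ne hc.1 hc.2, sub_self]
  all_goals simp

theorem sum_update (y : C → ℝ) (i : C) (t : ℝ) :
    ∑ c, Function.update y i t c = ∑ c, y c + (t - y i) := by
  rw [Finset.sum_update_of_mem (Finset.mem_univ i), ← Finset.sum_erase_add _ _ (Finset.mem_univ i),
    Finset.sdiff_singleton_eq_erase]
  ring

/-- Pair steps preserve the sum, and the last step moves it to an adjacent integer. The upper bound
ensures that room remains for the random completion. -/
theorem DependentRounding.card_le_ceil {y : C → ℝ} {μ : PMF (Finset C)}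
    (h : DependentRounding y μ) : ∀ T ∈ μ.support, (T.card : ℤ) ≤ ⌈∑ c, y c⌉ := by
  induction h with
  | done y T hT =>
    intro U hU
    rw [PMF.support_pure, Set.mem_singleton_iff] at hU
    subst hU
    have : ∑ c, y c = ((U.card : ℤ) : ℝ) := by
      rw [Int.cast_natCast, Finset.card_eq_sum_ones, Nat.cast_sum,
        ← Finset.sum_filter_add_sum_filter_not Finset.univ (· ∈ U) y,
        Finset.sum_eq_zero (s := Finset.univ.filter (· ∉ U)), add_zero, Finset.filter_univ_mem]
      · refine Finset.sum_congr rfl fun c hc => ?_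
        rcases hT c with h | h
        · simp [h.2]
        · exact absurd hc h.1
      · intro c hc
        rcases hT c with h | h
        · exact absurd h.1 (Finset.mem_filter.1 hc).2
        · exact h.2
    rw [this, Int.ceil_intCast]
  | pair y i j hij hi hj α β hα hβ μ₁ μ₂ μ h₁ h₂ hμ ih₁ ih₂ =>
    intro T hT
    rw [sum_shift y hij] at ih₁ ih₂
    exact (hμ.mem_support hT).elim (ih₁ T) (ih₂ T)
  | last y i hi hrest μ₁ μ₂ μ h₁ h₂ hμ ih₁ ih₂ =>
    intro T hT
    have hbin : ∀ c, Function.update y i 1 c = 0 ∨ Function.update y i 1 c = 1 := by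
      intro c
      rcases eq_or_ne c i with rfl | hc
      · simp
      · simpa [hc] using hrest c hc
    obtain ⟨z, hz⟩ := exists_int_sum_eq hbin
    -- Rounding up raises the sum by `1 - y i < 1`, so the integer reached is at most the ceiling.
    have hlt : (z : ℝ) - 1 < ∑ c, y c := by
      rw [← hz, sum_update]
      linarith [hi.1]
    have hz' : z ≤ ⌈∑ c, y c⌉ := by
      have := Int.lt_ceil.2 (by push_cast; exact hlt : ((z - 1 : ℤ) : ℝ) < ∑ c, y c)
      omega
    rcases hμ.mem_support hT with h | h
    · refine (ih₁ T h).trans ?_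
      rwa [hz, Int.ceil_intCast]
    · refine (ih₂ T h).trans (Int.ceil_mono ?_)
      rw [sum_update]
      linarith [hi.1]

/-- The coordinates lying strictly between `0` and `1`. -/
noncomputable def fractional (y : C → ℝ) : Finset C :=
  Finset.univ.filter fun c => y c ∈ Set.Ioo (0 : ℝ) 1

/-- Termination measure: the minima defining `α` and `β` make at least one of the two coordinates
integral. -/
theorem card_fractional_shift_lt {y : C → ℝ} {i j : C} (hij : i ≠ j)
    (hi : y i ∈ Set.Ioo (0 : ℝ) 1) (hj : y j ∈ Set.Ioo (0 : ℝ) 1) {t : ℝ}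
    (ht : y i + t ∉ Set.Ioo (0 : ℝ) 1 ∨ y j - t ∉ Set.Ioo (0 : ℝ) 1) :
    (fractional (shift y i j t)).card < (fractional y).card := by
  apply Finset.card_lt_card
  have hsub : fractional (shift y i j t) ⊆ fractional y := by
    intro c hc
    simp only [fractional, Finset.mem_filter, Finset.mem_univ, true_and] at hc ⊢
    by_cases h1 : c = i
    · exact h1 ▸ hi
    by_cases h2 : c = j
    · exact h2 ▸ hj
    rwa [shift_apply_of_ne h1 h2] at hc
  refine ⟨hsub, fun hsup => ?_⟩
  have hmi := hsup (by simpa [fractional] using hi : i ∈ fractional y)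
  have hmj := hsup (by simpa [fractional] using hj : j ∈ fractional y)
  simp only [fractional, Finset.mem_filter, Finset.mem_univ, true_and, shift_apply_left hij,
    shift_apply_right] at hmi hmj
  tauto

theorem exists_dependentRounding_of_forall_eq {y : C → ℝ} (hy : ∀ c, y c = 0 ∨ y c = 1) :
    ∃ μ, DependentRounding y μ := by
  refine ⟨_, .done y (Finset.univ.filter fun c => y c = 1) fun c => ?_⟩
  rcases hy c with h | h <;> simp [h]

theorem exists_dependentRounding (y : C → ℝ) (hy : ∀ c, y c ∈ Set.Icc (0 : ℝ) 1) :
    ∃ μ, DependentRounding y μ := by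
  induction hN : (fractional y).card using Nat.strong_induction_on generalizing y with
  | _ N ih =>
  have hnot {c : C} (hc : y c ∉ Set.Ioo (0 : ℝ) 1) : y c = 0 ∨ y c = 1 := by
    by_contra! hne
    exact hc ⟨lt_of_le_of_ne (hy c).1 hne.1.symm, lt_of_le_of_ne (hy c).2 hne.2⟩
  by_cases h0 : ∀ c, y c ∉ Set.Ioo (0 : ℝ) 1
  · exact exists_dependentRounding_of_forall_eq fun c => hnot (h0 c)
  push Not at h0
  obtain ⟨i, hi⟩ := h0
  by_cases h1 : ∀ j, j ≠ i → y j ∉ Set.Ioo (0 : ℝ) 1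
  · have hupd (t : ℝ) (ht : t = 0 ∨ t = 1) (c : C) :
        Function.update y i t c = 0 ∨ Function.update y i t c = 1 := by
      rcases eq_or_ne c i with rfl | hc
      · simpa using ht
      · simpa [hc] using hnot (h1 c hc)
    obtain ⟨μ₁, h₁⟩ := exists_dependentRounding_of_forall_eq (hupd 1 (.inr rfl))
    obtain ⟨μ₂, h₂⟩ := exists_dependentRounding_of_forall_eq (hupd 0 (.inl rfl))
    obtain ⟨μ, hμ⟩ := exists_isMixture (hy i) μ₁ μ₂
    exact ⟨μ, .last y i hi (fun j hj => hnot (h1 j hj)) μ₁ μ₂ μ h₁ h₂ hμ⟩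
  push Not at h1
  obtain ⟨j, hji, hj⟩ := h1
  have hij := hji.symm
  have hα0 : 0 < min (1 - y i) (y j) := lt_min (by linarith [hi.2]) hj.1
  have hβ0 : 0 < min (y i) (1 - y j) := lt_min hi.1 (by linarith [hj.2])
  obtain ⟨μ₁, h₁⟩ := ih _ (hN ▸ card_fractional_shift_lt hij hi hj (by
    rcases min_choice (1 - y i) (y j) with h | h <;> simp [h])) _ (shift_up_mem_Icc hij hy) rfl
  obtain ⟨μ₂, h₂⟩ := ih _ (hN ▸ card_fractional_shift_lt hij hi hj (by
    rcases min_choice (y i) (1 - y j) with h | h <;> simp [h])) _ (shift_down_mem_Icc hij hy) rfl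
  obtain ⟨μ, hμ⟩ := exists_isMixture (p := min (y i) (1 - y j) /
    (min (1 - y i) (y j) + min (y i) (1 - y j)))
    ⟨by positivity, (div_le_one (by positivity)).2 (by linarith)⟩ μ₁ μ₂
  exact ⟨μ, .pair y i j hij hi hj _ _ rfl rfl μ₁ μ₂ μ h₁ h₂ hμ⟩

end rounding

/-! ### Sampling without replacement. -/

section sampling

/-- The probability that a random `K`-set avoids `j` given points. Removing one more point
multiplies it by `1 - K/(M - j) ≤ 1 - K/M`. -/
theorem cast_choose_sub_le {M K : ℕ} (hK : K ≤ M) (j : ℕ) (hj : j ≤ M) :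
    ((M - j).choose K : ℝ) ≤ M.choose K * (1 - (K : ℝ) / M) ^ j := by
  induction j with
  | zero => simp
  | succ j ih =>
    have hM : (0 : ℝ) < M := by exact_mod_cast (by omega : 0 < M)
    have hq : 0 ≤ 1 - (K : ℝ) / M := by
      rw [sub_nonneg, div_le_one hM]
      exact_mod_cast hK
    obtain ⟨n, hn⟩ : ∃ n, M - j = n + 1 := ⟨M - j - 1, by omega⟩
    have hn' : M - (j + 1) = n := by omega
    rw [hn']
    rw [hn] at ih
    rw [pow_succ, ← mul_assoc]
    refine le_trans ?_ (mul_le_mul_of_nonneg_right (ih (by omega)) hq)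
    rcases le_or_gt K n with hKn | hKn
    · have h1 : (n.choose K : ℝ) * (n + 1) = (n + 1).choose K * (n + 1 - K) := by
        have := Nat.choose_mul_succ_eq n K
        have h2 : ((n + 1 - K : ℕ) : ℝ) = n + 1 - K := by
          rw [Nat.cast_sub (by omega)]; push_cast; ring
        rw [← h2]
        exact_mod_cast this
      have h3 : (n.choose K : ℝ) = (n + 1).choose K * (1 - K / (n + 1)) := by
        field_simp
        linarith
      rw [h3]
      have h4 : ((n : ℝ) + 1) ≤ M := by exact_mod_cast (by omega : n + 1 ≤ M)
      gcongr
    · rw [Nat.choose_eq_zero_of_lt hKn]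
      simpa using mul_nonneg (Nat.cast_nonneg _) hq

variable {C : Type*} [DecidableEq C]

theorem card_filter_disjoint_powersetCard {U R : Finset C} (hR : R ⊆ U) (K : ℕ) :
    ((U.powersetCard K).filter fun A => Disjoint R A).card = (U.card - R.card).choose K := by
  rw [← Finset.card_sdiff_of_subset hR, ← Finset.card_powersetCard]
  congr 1
  ext A
  simp only [Finset.mem_filter, Finset.mem_powersetCard, Finset.subset_sdiff, disjoint_comm]
  tauto

/-- Writing each factor as `b · 1[c ∉ A] + (1 - b)` and expanding gives avoidance events with
nonnegative coefficients. Bounding each as if the points were sampled independently, the sum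
refactors as a binomial expansion. -/
theorem sum_powersetCard_prod_le {U S : Finset C} (hS : S ⊆ U) {K : ℕ} (hK : K ≤ U.card) {b : ℝ}
    (hb : b ∈ Set.Icc (0 : ℝ) 1) :
    ∑ A ∈ U.powersetCard K, ∏ c ∈ S, (if c ∈ A then 1 - b else 1) ≤
      U.card.choose K * (1 - b * ((K : ℝ) / U.card)) ^ S.card := by
  have hb' : 0 ≤ 1 - b := by linarith [hb.2]
  have hb0 := hb.1
  have hexp (A : Finset C) : ∏ c ∈ S, (if c ∈ A then 1 - b else 1) =
      ∑ R ∈ S.powerset, (if Disjoint R A then 1 else 0) * (b ^ R.card * (1 - b) ^ (S \ R).card) := by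
    have h1 : ∏ c ∈ S, (if c ∈ A then 1 - b else 1) =
        ∏ c ∈ S, (b * (if c ∈ A then 0 else 1) + (1 - b)) :=
      Finset.prod_congr rfl fun c _ => by split_ifs <;> ring
    rw [h1, Finset.prod_add]
    refine Finset.sum_congr rfl fun R _ => ?_
    rw [Finset.prod_mul_distrib, Finset.prod_const, Finset.prod_const]
    have h2 : (∏ c ∈ R, if c ∈ A then (0 : ℝ) else 1) = if Disjoint R A then 1 else 0 := by
      split_ifs with hd
      · exact Finset.prod_eq_one fun c hc => if_neg (Finset.disjoint_left.1 hd hc)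
      · rw [Finset.not_disjoint_iff] at hd
        obtain ⟨c, hc, hcA⟩ := hd
        exact Finset.prod_eq_zero hc (if_pos hcA)
    rw [h2]
    ring
  simp only [hexp]
  rw [Finset.sum_comm]
  have hR : ∀ R ∈ S.powerset,
      ∑ A ∈ U.powersetCard K,
        (if Disjoint R A then (1 : ℝ) else 0) * (b ^ R.card * (1 - b) ^ (S \ R).card) ≤
      U.card.choose K * ((b * (1 - (K : ℝ) / U.card)) ^ R.card * (1 - b) ^ (S \ R).card) := by
    intro R hR
    have hRU := (Finset.mem_powerset.1 hR).trans hS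
    rw [← Finset.sum_mul, Finset.sum_boole, card_filter_disjoint_powersetCard hRU, mul_pow]
    have := cast_choose_sub_le hK R.card (Finset.card_le_card hRU)
    calc _ ≤ (U.card.choose K * (1 - (K : ℝ) / U.card) ^ R.card) *
          (b ^ R.card * (1 - b) ^ (S \ R).card) := by gcongr
      _ = _ := by ring
  refine (Finset.sum_le_sum hR).trans (le_of_eq ?_)
  rw [← Finset.mul_sum]
  congr 1
  have := Finset.prod_add (fun _ : C => b * (1 - (K : ℝ) / U.card)) (fun _ => 1 - b) S
  simp only [Finset.prod_const] at this
  rw [← this]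
  ring

end sampling

/-! ### Product bounds and committee size for the whole algorithm. -/

section algorithm

variable {n m k : ℕ}

/-- Members of `T₁` contribute deterministically; the rest of `S` is sampled at a rate of at least
`q`. -/
theorem mean_completeUniformly_prod_le (hkm : k ≤ m) (T₁ S : Finset (Fin m)) {b q : ℝ}
    (hb : b ∈ Set.Icc (0 : ℝ) 1)
    (hq : q ≤ ((k - T₁.card : ℕ) : ℝ) / ((m - T₁.card : ℕ) : ℝ)) :
    mean (completeUniformly hkm T₁) (fun T => ∏ c ∈ S, if c ∈ T then 1 - b else 1) ≤
      ∏ c ∈ S, if c ∈ T₁ then 1 - b else 1 - b * q := by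
  have hcard : T₁ᶜ.card = m - T₁.card := by rw [Finset.card_compl, Fintype.card_fin]
  have hK : k - T₁.card ≤ T₁ᶜ.card := by omega
  have hchoose : (0 : ℝ) < T₁ᶜ.card.choose (k - T₁.card) := by exact_mod_cast Nat.choose_pos hK
  have hb' : 0 ≤ 1 - b := by linarith [hb.2]
  rw [completeUniformly, mean_map, mean_uniformOfFinset, Finset.card_powersetCard,
    div_le_iff₀ hchoose]
  have hsplit (A : Finset (Fin m)) : (∏ c ∈ S, if c ∈ T₁ ∪ A then 1 - b else 1) =
      (∏ c ∈ S with c ∈ T₁, (1 - b)) * ∏ c ∈ S with c ∉ T₁, if c ∈ A then 1 - b else 1 := by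
    rw [← Finset.prod_filter_mul_prod_filter_not S (· ∈ T₁)]
    congr 1 <;> refine Finset.prod_congr rfl fun c hc => ?_ <;>
      simp [(Finset.mem_filter.1 hc).2]
  have hsub : S.filter (· ∉ T₁) ⊆ T₁ᶜ := fun c hc => by simpa using (Finset.mem_filter.1 hc).2
  have hKM : (0 : ℝ) ≤ 1 - b * (((k - T₁.card : ℕ) : ℝ) / T₁ᶜ.card) := by
    have : ((k - T₁.card : ℕ) : ℝ) / T₁ᶜ.card ≤ 1 :=
      div_le_one_of_le₀ (by exact_mod_cast hK) (by positivity)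
    have h0 : 0 ≤ ((k - T₁.card : ℕ) : ℝ) / T₁ᶜ.card := by positivity
    nlinarith [hb.1]
  simp only [hsplit]
  rw [← Finset.mul_sum]
  calc _ ≤ (∏ c ∈ S with c ∈ T₁, (1 - b)) * (T₁ᶜ.card.choose (k - T₁.card) *
        (1 - b * (((k - T₁.card : ℕ) : ℝ) / T₁ᶜ.card)) ^ (S.filter (· ∉ T₁)).card) :=
      mul_le_mul_of_nonneg_left (sum_powersetCard_prod_le hsub hK hb)
        (Finset.prod_nonneg fun _ _ => hb')
    _ ≤ (∏ c ∈ S with c ∈ T₁, (1 - b)) * (T₁ᶜ.card.choose (k - T₁.card) *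
        (1 - b * q) ^ (S.filter (· ∉ T₁)).card) := by
      rw [hcard] at hKM ⊢
      have := hb.1
      gcongr
    _ = _ := by
      rw [← Finset.prod_filter_mul_prod_filter_not S (· ∈ T₁) fun c =>
        if c ∈ T₁ then 1 - b else 1 - b * q, ← Finset.prod_const (1 - b * q)]
      have h1 : (∏ c ∈ S with c ∈ T₁, if c ∈ T₁ then 1 - b else 1 - b * q) =
          ∏ c ∈ S with c ∈ T₁, (1 - b) :=
        Finset.prod_congr rfl fun c hc => if_pos (Finset.mem_filter.1 hc).2
      have h2 : (∏ c ∈ S with c ∉ T₁, if c ∈ T₁ then 1 - b else 1 - b * q) =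
          ∏ c ∈ S with c ∉ T₁, (1 - b * q) :=
        Finset.prod_congr rfl fun c hc => if_neg (Finset.mem_filter.1 hc).2
      rw [h1, h2]
      ring

theorem mean_bind_completeUniformly_prod_le (hkm : k ≤ m) {y : Fin m → ℝ}
    {ν : PMF (Finset (Fin m))} (hν : DependentRounding y ν)
    (hy : ∀ c, y c ∈ Set.Icc (0 : ℝ) 1) (S : Finset (Fin m)) {b q : ℝ}
    (hb : b ∈ Set.Icc (0 : ℝ) 1) (hq0 : 0 ≤ q) (hq1 : q < 1)
    (hq : ∀ T₁ ∈ ν.support, q ≤ ((k - T₁.card : ℕ) : ℝ) / ((m - T₁.card : ℕ) : ℝ)) :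
    mean (ν.bind (completeUniformly hkm)) (fun T => ∏ c ∈ S, if c ∈ T then 1 - b else 1) ≤
      (1 - b * q) ^ S.card * Real.exp (-(b * (1 - q) * ∑ c ∈ S, y c)) := by
  have hbq : 0 < 1 - b * q := by nlinarith [hb.1, hb.2]
  -- Chosen so that `1 - b = (1 - bq)(1 - b')`: a factor `1 - bq` comes out for every `c ∈ S`,
  -- leaving a product to which the rounding bound applies with `b'`.
  set b' : ℝ := 1 - (1 - b) / (1 - b * q) with hb'_def
  have hb'eq : b' = b * (1 - q) / (1 - b * q) := by rw [hb'_def]; field_simp; ring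
  have hb'mem : b' ∈ Set.Icc (0 : ℝ) 1 := by
    have h1 : 0 ≤ (1 - b) / (1 - b * q) := div_nonneg (by linarith [hb.2]) hbq.le
    refine ⟨?_, by linarith⟩
    rw [hb'eq]
    exact div_nonneg (mul_nonneg hb.1 (by linarith)) hbq.le
  have hb'le : b * (1 - q) ≤ b' := by
    rw [hb'eq, le_div_iff₀ hbq]
    have h1 : 0 ≤ b * (1 - q) := mul_nonneg hb.1 (by linarith)
    nlinarith [mul_nonneg h1 (mul_nonneg hb.1 hq0)]
  have hfac (T₁ : Finset (Fin m)) : (∏ c ∈ S, if c ∈ T₁ then 1 - b else 1 - b * q) =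
      (1 - b * q) ^ S.card * ∏ c ∈ S, if c ∈ T₁ then 1 - b' else 1 := by
    rw [← Finset.prod_const, ← Finset.prod_mul_distrib]
    refine Finset.prod_congr rfl fun c _ => ?_
    split_ifs
    · rw [hb'_def]; field_simp; ring
    · ring
  rw [mean_bind]
  refine (mean_mono fun T₁ hT₁ => mean_completeUniformly_prod_le hkm T₁ S hb (hq T₁ hT₁)).trans ?_
  simp only [hfac]
  rw [mean_const_mul]
  refine mul_le_mul_of_nonneg_left ((hν.mean_prod_le hy S hb'mem).trans ?_) (by positivity)
  rw [Finset.mul_sum, ← Finset.sum_neg_distrib, Real.exp_sum]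
  refine Finset.prod_le_prod (fun c _ => ?_) fun c _ => ?_
  · nlinarith [hb'mem.1, hb'mem.2, (hy c).1, (hy c).2]
  · have h1 := Real.add_one_le_exp (-(b * (1 - q) * y c))
    nlinarith [(hy c).1]

theorem card_of_mem_support_completeUniformly (hkm : k ≤ m) {T₁ T : Finset (Fin m)}
    (hT₁ : T₁.card ≤ k) (hT : T ∈ (completeUniformly hkm T₁).support) : T.card = k := by
  rw [completeUniformly, PMF.mem_support_map_iff] at hT
  obtain ⟨A, hA, rfl⟩ := hT
  rw [PMF.mem_support_uniformOfFinset_iff, Finset.mem_powersetCard] at hA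
  rw [Finset.card_union_of_disjoint, hA.2]
  · omega
  · exact Finset.disjoint_left.2 fun c hc hcA => Finset.mem_compl.1 (hA.1 hcA) hc

end algorithm

/-! ### Threshold decomposition of a voter's cost. -/

section cost

variable {n m k : ℕ}

/-- The candidates that voter `v` ranks among the first `t`. -/
def topSet (r : Profile n m) (v : Fin n) (t : ℕ) : Finset (Fin m) :=
  Finset.univ.filter fun c => (r v c : ℕ) < t

theorem card_topSet (r : Profile n m) (v : Fin n) {t : ℕ} (ht : t ≤ m) :
    (topSet r v t).card = t := by
  have : topSet r v t = (Finset.univ.filter fun c : Fin m => (c : ℕ) < t).map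
      (r v).symm.toEmbedding := by
    ext c
    simp [topSet, Finset.mem_map_equiv]
  rw [this, Finset.card_map, Fin.card_filter_val_lt, min_eq_right ht]

theorem rank_eq_sum (r : Profile n m) (v : Fin n) (c : Fin m) :
    (rank r v c : ℝ) = ∑ t ∈ Finset.range m, if c ∈ topSet r v t then 0 else 1 := by
  have h : (Finset.range m).filter (fun t => c ∉ topSet r v t) = Finset.range (rank r v c) := by
    ext t
    have := (r v c).isLt
    simp only [topSet, rank, Finset.mem_filter, Finset.mem_range, Finset.mem_univ, true_and]
    omega
  have h2 : (∑ t ∈ Finset.range m, if c ∈ topSet r v t then (0 : ℝ) else 1) =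
      ∑ t ∈ Finset.range m, if c ∉ topSet r v t then (1 : ℝ) else 0 :=
    Finset.sum_congr rfl fun t _ => by split_ifs <;> simp_all
  rw [h2, Finset.sum_boole, h, Finset.card_range]

theorem exists_voterCost_eq (r : Profile n m) {s : ℕ} (v : Fin n) {T : Finset (Fin m)}
    (hs : s ≤ T.card) : ∃ Q ⊆ T, Q.card = s ∧ voterCost r s v T = ∑ c ∈ Q, (rank r v c : ℝ) := by
  obtain ⟨Q₀, hQ₀, hc₀⟩ := Finset.exists_subset_card_eq hs
  have : Nonempty {Q : Finset (Fin m) // Q ⊆ T ∧ Q.card = s} := ⟨⟨Q₀, hQ₀, hc₀⟩⟩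
  obtain ⟨Q, hQ⟩ := exists_eq_ciInf_of_finite
    (f := fun Q : {Q : Finset (Fin m) // Q ⊆ T ∧ Q.card = s} => ∑ c ∈ Q.1, (rank r v c : ℝ))
  exact ⟨Q.1, Q.2.1, Q.2.2, hQ.symm⟩

theorem voterCost_le (r : Profile n m) {s : ℕ} (v : Fin n) {T Q : Finset (Fin m)}
    (hQ : Q ⊆ T) (hs : Q.card = s) : voterCost r s v T ≤ ∑ c ∈ Q, (rank r v c : ℝ) :=
  ciInf_le (f := fun Q : {Q : Finset (Fin m) // Q ⊆ T ∧ Q.card = s} =>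
    ∑ c ∈ Q.1, (rank r v c : ℝ)) (Set.finite_range _).bddBelow ⟨Q, hQ, hs⟩

theorem voterCost_le_sum_max (r : Profile n m) {s : ℕ} (v : Fin n) {T : Finset (Fin m)}
    (hs : s ≤ T.card) :
    voterCost r s v T ≤
      ∑ t ∈ Finset.range m, max ((s : ℝ) - (topSet r v t ∩ T).card) 0 := by
  obtain ⟨Q, hQT, hQs, hQ⟩ := exists_voterCost_eq r v hs
  -- Otherwise swapping `c` for `d` would improve the optimal `Q`.
  have hexch : ∀ c ∈ Q, ∀ d ∈ T, d ∉ Q → rank r v c ≤ rank r v d := by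
    intro c hc d hd hdQ
    have h1 : d ∉ Q.erase c := fun h => hdQ (Finset.mem_of_mem_erase h)
    have h2 := voterCost_le r (s := s) v (T := T) (Q := insert d (Q.erase c))
      (Finset.insert_subset hd ((Finset.erase_subset _ _).trans hQT))
      (by rw [Finset.card_insert_of_notMem h1, Finset.card_erase_add_one hc, hQs])
    rw [hQ, Finset.sum_insert h1, ← Finset.add_sum_erase Q _ hc] at h2
    exact_mod_cast le_of_add_le_add_right h2
  rw [hQ]
  simp only [rank_eq_sum]
  rw [Finset.sum_comm]
  refine Finset.sum_le_sum fun t _ => ?_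
  by_cases hsub : Q ⊆ topSet r v t
  · rw [Finset.sum_eq_zero fun c hc => if_pos (hsub hc)]
    exact le_max_right _ _
  · obtain ⟨c, hcQ, hct⟩ := Finset.not_subset.1 hsub
    -- Once `Q` leaves the top `t`, the exchange property forces every member of `T` in the top `t`
    -- to be in `Q`, so the shortfall is exact.
    have hQt : topSet r v t ∩ T = topSet r v t ∩ Q := by
      refine Finset.Subset.antisymm (fun d hd => ?_) (Finset.inter_subset_inter_left hQT)
      rw [Finset.mem_inter] at hd ⊢
      refine ⟨hd.1, by_contra fun hdQ => ?_⟩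
      have := hexch c hcQ d hd.2 hdQ
      simp only [topSet, rank, Finset.mem_filter, Finset.mem_univ, true_and] at hct hd this
      omega
    have hsum : (∑ c ∈ Q, if c ∈ topSet r v t then (0 : ℝ) else 1) =
        s - (topSet r v t ∩ T).card := by
      have h1 : ∀ c, (if c ∈ topSet r v t then (0 : ℝ) else 1) =
          1 - if c ∈ topSet r v t then 1 else 0 := fun c => by split_ifs <;> simp
      simp only [h1]
      rw [Finset.sum_sub_distrib, Finset.sum_boole, Finset.filter_mem_eq_inter, hQt,
        Finset.inter_comm Q]
      simp [hQs]
    rw [hsum]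
    exact le_max_left _ _

end cost

/-! ### The LP: lower bound, relaxation, existence of an optimum. -/

section linearProgram

variable {n m k s : ℕ}

/-- The `s` charged copies carry mass at least `s`, of which at most the `y`-mass of the top `t`
fits inside it; the excess pays one unit at threshold `t`. -/
theorem sum_max_le_voter_lp_cost (r : Profile n m) (hs : s ≤ k) {y : Fin m → ℝ}
    {x : Fin n → Fin m → Fin k → ℝ} (hx : LPFeasible k y x) (v : Fin n) :
    ∑ t ∈ Finset.range m, max ((s : ℝ) - ∑ c ∈ topSet r v t, y c) 0 ≤
      ∑ l ∈ Finset.univ.filter (fun l : Fin k => (l : ℕ) < s), ∑ j, x v j l * (rank r v j : ℝ) := by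
  set L := Finset.univ.filter (fun l : Fin k => (l : ℕ) < s)
  have hL : L.card = s := by rw [Fin.card_filter_val_lt, min_eq_right hs]
  have heq : ∑ l ∈ L, ∑ j, x v j l * (rank r v j : ℝ) =
      ∑ t ∈ Finset.range m, ∑ l ∈ L, ∑ j, x v j l * (if j ∈ topSet r v t then 0 else 1) := by
    simp only [rank_eq_sum, Finset.mul_sum]
    rw [Finset.sum_comm (s := Finset.range m)]
    exact Finset.sum_congr rfl fun l _ => Finset.sum_comm
  rw [heq]
  refine Finset.sum_le_sum fun t _ => max_le ?_ ?_
  · have h1 : (s : ℝ) ≤ ∑ l ∈ L, ∑ j, x v j l := by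
      calc (s : ℝ) = ∑ l ∈ L, 1 := by simp [hL]
        _ ≤ _ := Finset.sum_le_sum fun l _ => hx.one_le_sum_x v l
    have h2 : ∑ j ∈ topSet r v t, ∑ l ∈ L, x v j l ≤ ∑ j ∈ topSet r v t, y j :=
      Finset.sum_le_sum fun j _ => (Finset.sum_le_sum_of_subset_of_nonneg (Finset.subset_univ L)
        fun l _ _ => (hx.x_mem v j l).1).trans (hx.sum_x_le v j)
    have h3 : ∑ l ∈ L, ∑ j, x v j l * (if j ∈ topSet r v t then 0 else 1) =
        ∑ l ∈ L, ∑ j, x v j l - ∑ j ∈ topSet r v t, ∑ l ∈ L, x v j l := by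
      rw [Finset.sum_comm (s := topSet r v t), ← Finset.sum_sub_distrib]
      refine Finset.sum_congr rfl fun l _ => ?_
      rw [← Finset.sum_filter_add_sum_filter_not Finset.univ (· ∈ topSet r v t) fun j => x v j l,
        Finset.filter_univ_mem, add_sub_cancel_left, Finset.sum_filter]
      exact Finset.sum_congr rfl fun j _ => by by_cases h : j ∈ topSet r v t <;> simp [h]
    linarith
  · refine Finset.sum_nonneg fun l _ => Finset.sum_nonneg fun j _ =>
      mul_nonneg (hx.x_mem v j l).1 ?_
    split_ifs <;> simp

/-- The LP requires all `k` copies to be served, so a bijection from the charged copies onto the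
optimal `Q` is extended to one from all copies onto `T`. -/
theorem exists_injective_sum_rank_eq (r : Profile n m) (hs : s ≤ k) {T : Finset (Fin m)}
    (hT : T.card = k) (v : Fin n) :
    ∃ σ : Fin k → Fin m, Function.Injective σ ∧ (∀ l, σ l ∈ T) ∧
      ∑ l ∈ Finset.univ.filter (fun l : Fin k => (l : ℕ) < s), (rank r v (σ l) : ℝ) =
        voterCost r s v T := by
  obtain ⟨Q, hQT, hQs, hQ⟩ := exists_voterCost_eq r v (hT ▸ hs : s ≤ T.card)
  set L := Finset.univ.filter (fun l : Fin k => (l : ℕ) < s) with hLdef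
  have hL : L.card = s := by rw [Fin.card_filter_val_lt, min_eq_right hs]
  let e₀ : Fin k ≃ T := (T.equivFinOfCardEq hT).symm
  have h1 : Fintype.card {c : T // e₀.symm c ∈ L} = s := by
    rw [← Fintype.card_congr (e₀.subtypeEquiv (p := (· ∈ L)) (by simp)), Fintype.card_coe, hL]
  have h2 : Fintype.card {c : T // (c : Fin m) ∈ Q} = s := by
    rw [← hQs, ← Fintype.card_coe Q]
    exact Fintype.card_congr (Equiv.subtypeSubtypeEquivSubtype fun h => hQT h)
  let e := Fintype.equivOfCardEq (h1.trans h2.symm)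
  let σ : Fin k → Fin m := fun l => (e.extendSubtype (e₀ l) : T)
  have hinj : Function.Injective σ :=
    Subtype.val_injective.comp (e.extendSubtype.injective.comp e₀.injective)
  have himg : L.image σ = Q := by
    refine Finset.eq_of_subset_of_card_le (fun c hc => ?_) ?_
    · obtain ⟨l, hl, rfl⟩ := Finset.mem_image.1 hc
      exact e.extendSubtype_mem (e₀ l) (by simpa using hl)
    · rw [Finset.card_image_of_injective _ hinj, hL, hQs]
  refine ⟨σ, hinj, fun l => (e.extendSubtype (e₀ l) : T).2, ?_⟩
  rw [hQ, ← himg, Finset.sum_image hinj.injOn]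

theorem exists_lpFeasible_lpObjective_eq (r : Profile n m) (hs : s ≤ k) {T : Finset (Fin m)}
    (hT : T.card = k) :
    ∃ (y : Fin m → ℝ) (x : Fin n → Fin m → Fin k → ℝ), LPFeasible k y x ∧
      lpObjective r k s x = ∑ v, voterCost r s v T := by
  choose σ hinj hmem hsum using exists_injective_sum_rank_eq r hs hT
  refine ⟨fun j => if j ∈ T then 1 else 0, fun v j l => if j = σ v l then 1 else 0,
    ⟨?_, fun v j => ?_, fun v l => ?_, fun j => ?_, fun v j l => ?_⟩, ?_⟩
  · simp [hT]
  · rw [Finset.sum_boole]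
    split_ifs with hj
    · norm_cast
      refine Finset.card_le_one.2 fun a ha b hb => hinj v ?_
      rw [← (Finset.mem_filter.1 ha).2, ← (Finset.mem_filter.1 hb).2]
    · norm_cast
      rw [Nat.le_zero, Finset.card_eq_zero, Finset.filter_eq_empty_iff]
      rintro l - rfl
      exact hj (hmem v l)
  · simp
  · split_ifs <;> simp
  · split_ifs <;> simp
  · refine Finset.sum_congr rfl fun v _ => ?_
    rw [← hsum v]
    exact Finset.sum_congr rfl fun l _ => by simp

theorem lpObjective_le_opt (r : Profile n m) (hs : s ≤ k) (hkm : k ≤ m)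
    {x : Fin n → Fin m → Fin k → ℝ}
    (hx : ∀ (y' : Fin m → ℝ) (x' : Fin n → Fin m → Fin k → ℝ), LPFeasible k y' x' →
      lpObjective r k s x ≤ lpObjective r k s x') :
    (1 / (n : ℝ)) * lpObjective r k s x ≤ opt r k s := by
  obtain ⟨T₀, -, hT₀⟩ := Finset.exists_subset_card_eq
    (by simpa using hkm : k ≤ (Finset.univ : Finset (Fin m)).card)
  have : Nonempty {T : Finset (Fin m) // T.card = k} := ⟨⟨T₀, hT₀⟩⟩
  refine le_ciInf fun T => ?_
  obtain ⟨y', x', hf, hobj⟩ := exists_lpFeasible_lpObjective_eq r hs T.2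
  rw [score, ← hobj]
  exact mul_le_mul_of_nonneg_left (hx y' x' hf) (by positivity)

theorem exists_isLPOptimal (r : Profile n m) (hs : s ≤ k) (hkm : k ≤ m) :
    ∃ y, IsLPOptimal r k s y := by
  let K : Set ((Fin m → ℝ) × (Fin n → Fin m → Fin k → ℝ)) := {p | LPFeasible k p.1 p.2}
  have hK : K = {p | ∑ j, p.1 j = (k : ℝ)} ∩ {p | ∀ i j, ∑ l, p.2 i j l ≤ p.1 j} ∩
      {p | ∀ i l, 1 ≤ ∑ j, p.2 i j l} ∩ Set.Icc 0 1 := by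
    ext p
    constructor
    · intro h
      exact ⟨⟨⟨h.sum_y, h.sum_x_le⟩, h.one_le_sum_x⟩,
        ⟨fun j => (h.y_mem j).1, fun i j l => (h.x_mem i j l).1⟩,
        ⟨fun j => (h.y_mem j).2, fun i j l => (h.x_mem i j l).2⟩⟩
    · rintro ⟨⟨⟨h1, h2⟩, h3⟩, h4, h5⟩
      exact ⟨h1, h2, h3, fun j => ⟨h4.1 j, h5.1 j⟩, fun i j l => ⟨h4.2 i j l, h5.2 i j l⟩⟩
  have hcomp : IsCompact K := by
    rw [hK]
    refine isCompact_Icc.inter_left (((isClosed_eq ?_ continuous_const).inter ?_).inter ?_)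
    · fun_prop
    · simp only [Set.ofPred_forall]
      exact isClosed_iInter fun i => isClosed_iInter fun j =>
        isClosed_le (by fun_prop) (by fun_prop)
    · simp only [Set.ofPred_forall]
      exact isClosed_iInter fun i => isClosed_iInter fun l =>
        isClosed_le (by fun_prop) (by fun_prop)
  obtain ⟨T, -, hT⟩ := Finset.exists_subset_card_eq
    (by simpa using hkm : k ≤ (Finset.univ : Finset (Fin m)).card)
  obtain ⟨y₀, x₀, h₀, -⟩ := exists_lpFeasible_lpObjective_eq r hs hT
  have hcont : Continuous fun p : (Fin m → ℝ) × (Fin n → Fin m → Fin k → ℝ) =>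
      lpObjective r k s p.2 := by
    unfold lpObjective
    fun_prop
  obtain ⟨p, hp, hmin⟩ := hcomp.exists_isMinOn ⟨(y₀, x₀), h₀⟩ hcont.continuousOn
  exact ⟨p.1, p.2, hp, fun y' x' h' => hmin (show (y', x') ∈ K from h')⟩

end linearProgram

/-! ### Analytic estimates, the shortfall bound and the expected score. -/

open Real

/-- Invert `exp a ≥ 1 + a + a²/2`, using `(1 - a + a²/2)(1 + a + a²/2) = 1 + a⁴/4`. -/
theorem le_one_sub_exp_neg {a : ℝ} (ha : 0 ≤ a) : a - a ^ 2 / 2 ≤ 1 - exp (-a) := by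
  have h1 := quadratic_le_exp_of_nonneg ha
  have h2 : exp a * exp (-a) = 1 := by rw [← exp_add]; simp
  have h3 : (1 + a + a ^ 2 / 2) * exp (-a) ≤ 1 :=
    (mul_le_mul_of_nonneg_right h1 (exp_pos _).le).trans_eq h2
  have h4 : 1 ≤ (1 - a + a ^ 2 / 2) * (1 + a + a ^ 2 / 2) := by nlinarith [sq_nonneg (a ^ 2)]
  have h5 : (1 + a + a ^ 2 / 2) * exp (-a) ≤ (1 + a + a ^ 2 / 2) * (1 - a + a ^ 2 / 2) := by
    linarith
  have := le_of_mul_le_mul_left h5 (by positivity)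
  linarith

theorem sum_pow_one_sub_le {x : ℝ} (hx0 : 0 < x) (hx1 : x ≤ 1) (m : ℕ) :
    ∑ t ∈ Finset.range m, (1 - x) ^ t ≤ 1 / x := by
  have h := mul_neg_geom_sum (1 - x) m
  rw [sub_sub_cancel] at h
  rw [le_div_iff₀ hx0, mul_comm, h]
  have : 0 ≤ (1 - x) ^ m := pow_nonneg (by linarith) m
  linarith

section

variable {n m k s : ℕ}

theorem sum_scaled_eq {y : Fin m → ℝ} (hy : ∑ j, y j = k) (a : ℝ) :
    ∑ j, (1 - a) * y j = (1 - a) * k := by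
  rw [← Finset.mul_sum, hy]

theorem card_le_of_mem_support {y : Fin m → ℝ} {ν : PMF (Finset (Fin m))} {a : ℝ} (ha : 0 ≤ a)
    (hy : ∑ j, y j = k) (hν : DependentRounding (fun j => (1 - a) * y j) ν)
    {T₁ : Finset (Fin m)} (hT₁ : T₁ ∈ ν.support) :
    T₁.card ≤ k ∧ (T₁.card : ℝ) ≤ (1 - a) * k + 1 := by
  have h := hν.card_le_ceil T₁ hT₁
  rw [sum_scaled_eq hy] at h
  constructor
  · have h1 : ⌈(1 - a) * (k : ℝ)⌉ ≤ k := Int.ceil_le.2 (by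
      push_cast
      nlinarith [Nat.cast_nonneg (α := ℝ) k])
    exact_mod_cast h.trans h1
  · have h1 : ((T₁.card : ℤ) : ℝ) ≤ ⌈(1 - a) * (k : ℝ)⌉ := by exact_mod_cast h
    have h2 := Int.ceil_lt_add_one ((1 - a) * (k : ℝ))
    push_cast at h1
    linarith

/-- Rounding up costs at most one seat, and `ak - 1 ≥ ak/2` because `ak ≥ 2`. -/
theorem sampling_rate_le {y : Fin m → ℝ} {ν : PMF (Finset (Fin m))} {a : ℝ} (ha : 0 ≤ a)
    (hkm : k ≤ m) (hak : 2 ≤ a * k) (hy : ∑ j, y j = k)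
    (hν : DependentRounding (fun j => (1 - a) * y j) ν)
    {T₁ : Finset (Fin m)} (hT₁ : T₁ ∈ ν.support) :
    a * k / (2 * m) ≤ ((k - T₁.card : ℕ) : ℝ) / ((m - T₁.card : ℕ) : ℝ) := by
  obtain ⟨h1, h2⟩ := card_le_of_mem_support ha hy hν hT₁
  have h3 : a * k / 2 ≤ ((k - T₁.card : ℕ) : ℝ) := by
    rw [Nat.cast_sub h1]
    linarith
  have h4 : (0 : ℝ) < ((m - T₁.card : ℕ) : ℝ) := by
    have : ((k - T₁.card : ℕ) : ℝ) ≤ ((m - T₁.card : ℕ) : ℝ) := by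
      exact_mod_cast Nat.sub_le_sub_right hkm _
    linarith
  have h5 : ((m - T₁.card : ℕ) : ℝ) ≤ m := by exact_mod_cast Nat.sub_le _ _
  rw [← div_div]
  gcongr

/-- The exponential moment bound for the number of chosen candidates inside a set `S`. -/
theorem mean_exp_neg_card_le {y : Fin m → ℝ} {ν : PMF (Finset (Fin m))} {a q : ℝ} (ha : 0 ≤ a)
    (ha1 : a ≤ 1) (hkm : k ≤ m) (hy : ∀ c, y c ∈ Set.Icc (0 : ℝ) 1)
    (hν : DependentRounding (fun j => (1 - a) * y j) ν) (hq0 : 0 ≤ q) (hq1 : q < 1)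
    (hq : ∀ T₁ ∈ ν.support, q ≤ ((k - T₁.card : ℕ) : ℝ) / ((m - T₁.card : ℕ) : ℝ))
    (S : Finset (Fin m)) :
    mean (ν.bind (completeUniformly hkm)) (fun T => exp (-(a * (S ∩ T).card))) ≤
      (1 - (1 - exp (-a)) * q) ^ S.card *
        exp (-((1 - exp (-a)) * (1 - q) * ((1 - a) * ∑ c ∈ S, y c))) := by
  have hb : 1 - exp (-a) ∈ Set.Icc (0 : ℝ) 1 :=
    ⟨by simpa using ha, by linarith [exp_pos (-a)]⟩
  have hy' : ∀ c, (1 - a) * y c ∈ Set.Icc (0 : ℝ) 1 := fun c =>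
    ⟨mul_nonneg (by linarith) (hy c).1, mul_le_one₀ (by linarith) (hy c).1 (hy c).2⟩
  have h := mean_bind_completeUniformly_prod_le hkm hν hy' S hb hq0 hq1 hq
  rw [← Finset.mul_sum] at h
  refine le_trans (le_of_eq ?_) h
  congr 1
  funext T
  rw [sub_sub_cancel, Finset.prod_ite, Finset.prod_const, Finset.prod_const_one, mul_one,
    Finset.filter_mem_eq_inter, ← exp_nat_mul]
  congr 1
  ring

theorem max_le_mul_exp {w a x : ℝ} (hw : 0 ≤ w) (hwa : w * a = 1) :
    max x 0 ≤ w * exp (a * x - 1) := by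
  refine max_le ?_ (by positivity)
  have h1 := add_one_le_exp (a * x - 1)
  calc x = w * (a * x) := by rw [← mul_assoc, hwa, one_mul]
    _ ≤ _ := mul_le_mul_of_nonneg_left (by linarith) hw

/-- A bound on the expected shortfall `(s - N)⁺` from a bound on the exponential moment of `N`,
where the fractional solution has mass `F`. -/
theorem mean_shortfall_le {X : Type*} [Fintype X] (μ : PMF X) (N : X → ℝ) {w a q s F P : ℝ}
    (hw : 0 ≤ w) (hwa : w * a = 1) (hws : w ^ 2 = s) (ha0 : 0 ≤ a) (ha : a ≤ 1 / 2)
    (hq : q ≤ a / 2) (hF : 0 ≤ F) (hP0 : 0 ≤ P) (hP1 : P ≤ 1)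
    (hN : mean μ (fun T => exp (-(a * N T))) ≤
      P * exp (-((1 - exp (-a)) * (1 - q) * ((1 - a) * F)))) :
    mean μ (fun T => max (s - N T) 0) ≤ 3 * max (s - F) 0 + 27 * w * P := by
  have hb := le_one_sub_exp_neg ha0
  have has : a * s = w := by rw [← hws]; linear_combination w * hwa
  have haw : a * w = 1 := by linarith
  have hrate : a * (1 - a) ≤ (1 - exp (-a)) * (1 - q) := by
    have h1 : (a - a ^ 2 / 2) * (1 - a / 2) ≤ (1 - exp (-a)) * (1 - q) :=
      mul_le_mul hb (by linarith) (by linarith) (by nlinarith)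
    nlinarith [mul_nonneg ha0 (sq_nonneg a)]
  have hexp : mean μ (fun T => exp (-(a * N T))) ≤ P * exp (-(a * (1 - a) * ((1 - a) * F))) := by
    refine hN.trans ?_
    have : 0 ≤ (1 - a) * F := mul_nonneg (by linarith) hF
    gcongr
  -- The target `u` is free: it is `s` when `F` is large and the scaled mass `(1 - a)F` when `F` is
  -- small.
  have hbound (u : ℝ) : mean μ (fun T => max (u - N T) 0) ≤
      w * P * exp (a * u - 1 - a * (1 - a) * ((1 - a) * F)) := by
    calc mean μ (fun T => max (u - N T) 0)
        ≤ mean μ (fun T => w * exp (a * u - 1) * exp (-(a * N T))) := by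
          refine mean_mono fun T _ => (max_le_mul_exp hw hwa).trans (le_of_eq ?_)
          rw [mul_assoc, ← exp_add]
          ring_nf
      _ ≤ w * exp (a * u - 1) * (P * exp (-(a * (1 - a) * ((1 - a) * F)))) := by
          rw [mean_const_mul]
          gcongr
      _ = _ := by
          rw [sub_eq_add_neg (a * u - 1), exp_add]
          ring
  rcases le_or_gt ((1 - a) * s) F with hcase | hcase
  · have h1 : a * s - 1 - a * (1 - a) * ((1 - a) * F) ≤ 3 := by
      have h2 : a * (1 - a) * ((1 - a) * ((1 - a) * s)) ≤ a * (1 - a) * ((1 - a) * F) := by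
        have : 0 ≤ a * (1 - a) := mul_nonneg ha0 (by linarith)
        have : 0 ≤ 1 - a := by linarith
        gcongr
      -- The terms of order `w` cancel: the exponent is at most `w - 1 - w(1 - a)³ = 2 - 3a + a²`.
      have h3 : a * (1 - a) * ((1 - a) * ((1 - a) * s)) = w * (1 - a) ^ 3 := by
        rw [← has]; ring
      have h4 : w * (1 - a) ^ 3 = w - 3 + 3 * a - a ^ 2 := by
        linear_combination (-3 + 3 * a - a ^ 2) * haw
      nlinarith
    have h3 : exp 3 ≤ 27 := by
      have h4 : exp 3 = exp 1 ^ 3 := by rw [← exp_nat_mul]; norm_num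
      have h5 : exp 1 ≤ 3 := by linarith [exp_one_lt_d9]
      calc exp 3 = exp 1 ^ 3 := h4
        _ ≤ 3 ^ 3 := pow_le_pow_left₀ (exp_pos 1).le h5 3
        _ = 27 := by norm_num
    have h6 : 0 ≤ max (s - F) 0 := le_max_right _ _
    calc mean μ (fun T => max (s - N T) 0)
        ≤ w * P * exp (a * s - 1 - a * (1 - a) * ((1 - a) * F)) := hbound s
      _ ≤ w * P * 27 := by gcongr; exact (exp_le_exp.2 h1).trans h3
      _ ≤ _ := by linarith
  · have hs : 0 ≤ s := by rw [← hws]; positivity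
    have hFs : F ≤ s := by nlinarith
    set u := (1 - a) * F with hu
    have hus : u ≤ s := by nlinarith
    have hu0 : 0 ≤ u := mul_nonneg (by linarith) hF
    have h1 : a * u - 1 - a * (1 - a) * u ≤ 0 := by
      have h2 : a * (a * u) ≤ a * (a * s) := by gcongr
      rw [has, haw] at h2
      linarith
    have h2 : mean μ (fun T => max (u - N T) 0) ≤ w := by
      refine (hbound u).trans ?_
      calc w * P * exp (a * u - 1 - a * (1 - a) * u) ≤ w * 1 * 1 := by
            gcongr
            exact exp_le_one_iff.2 h1
        _ = w := by ring
    have h3 : mean μ (fun T => max (s - N T) 0) ≤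
        mean μ (fun T => (s - u) + max (u - N T) 0) := by
      refine mean_mono fun T _ => max_le ?_ ?_
      · linarith [le_max_left (u - N T) 0]
      · linarith [le_max_right (u - N T) 0]
    rw [mean_add, mean_const] at h3
    have h4 : s - F ≤ max (s - F) 0 := le_max_left _ _
    have h5 : a * F ≤ w := by rw [← has]; gcongr
    have h6 : 0 ≤ w * P := by positivity
    -- The factor 3: `s - F` itself, one more for the scaling loss `aF ≤ w`, and one for the mean
    -- shortfall below `u`, also at most `w`.
    have h7 : w ≤ s - F := by rw [← has]; linarith
    nlinarith

theorem mean_voterCost_le (r : Profile n m) (v : Fin n) {y : Fin m → ℝ}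
    {x : Fin n → Fin m → Fin k → ℝ} {ν : PMF (Finset (Fin m))} (hs : 4 ≤ s) (hsk : s ≤ k)
    (hkm : k ≤ m) (hwk : 2 * √s ≤ k) (hx : LPFeasible k y x)
    (hν : DependentRounding (fun j => (1 - 1 / √(s : ℝ)) * y j) ν) :
    mean (ν.bind (completeUniformly hkm)) (voterCost r s v) ≤
      3 * ∑ l ∈ Finset.univ.filter (fun l : Fin k => (l : ℕ) < s),
        ∑ j, x v j l * (rank r v j : ℝ) + 108 * (s * √s) * (m / k) := by
  set w := √(s : ℝ) with hw
  have hws : w ^ 2 = s := sq_sqrt (Nat.cast_nonneg s)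
  have hs' : (4 : ℝ) ≤ s := by exact_mod_cast hs
  have hw2 : 2 ≤ w := le_sqrt_of_sq_le (by linarith)
  set a := 1 / w with ha
  have hwa : w * a = 1 := by rw [ha]; field_simp
  have ha0 : 0 < a := by positivity
  have ha2 : a ≤ 1 / 2 := one_div_le_one_div_of_le (by norm_num) hw2
  have hk0 : (0 : ℝ) < k := by linarith
  have hkm' : (k : ℝ) ≤ m := by exact_mod_cast hkm
  have hm0 : (0 : ℝ) < m := by linarith
  have hak : 2 ≤ a * k := by rw [ha, one_div_mul_eq_div, le_div_iff₀ (by positivity)]; exact hwk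
  set q := a * k / (2 * m) with hq
  have hq0 : 0 < q := by positivity
  have hqa : q ≤ a / 2 := by
    rw [hq, div_le_div_iff₀ (by positivity) (by norm_num)]
    nlinarith
  set b := 1 - exp (-a) with hb
  have hab : a / 2 ≤ b := le_trans (by nlinarith) (le_one_sub_exp_neg ha0.le)
  have hb1 : b ≤ 1 := by linarith [exp_pos (-a)]
  have hbq0 : 0 < b * q := mul_pos (by linarith) hq0
  have hbq1 : b * q ≤ 1 := by nlinarith
  have hP0 (t : ℕ) : 0 ≤ (1 - b * q) ^ t := pow_nonneg (by linarith) t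
  set μ := ν.bind (completeUniformly hkm) with hμ
  have hcard : ∀ T ∈ μ.support, s ≤ T.card := by
    intro T hT
    obtain ⟨T₁, hT₁, hT⟩ := (PMF.mem_support_bind_iff _ _ _).1 hT
    rw [card_of_mem_support_completeUniformly hkm
      (card_le_of_mem_support ha0.le hx.sum_y hν hT₁).1 hT]
    exact hsk
  have hterm : ∀ t ∈ Finset.range m,
      mean μ (fun T => max ((s : ℝ) - (topSet r v t ∩ T).card) 0) ≤
      3 * max ((s : ℝ) - ∑ c ∈ topSet r v t, y c) 0 + 27 * w * (1 - b * q) ^ t := by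
    intro t ht
    have h := mean_exp_neg_card_le ha0.le (by linarith) hkm hx.y_mem hν hq0.le (by linarith)
      (fun T₁ hT₁ => sampling_rate_le ha0.le hkm hak hx.sum_y hν hT₁) (topSet r v t)
    rw [card_topSet r v (Finset.mem_range.1 ht).le] at h
    exact mean_shortfall_le μ (fun T => ((topSet r v t ∩ T).card : ℝ)) (by linarith) hwa hws
      ha0.le ha2 hqa (Finset.sum_nonneg fun c _ => (hx.y_mem c).1) (hP0 t)
      (pow_le_one₀ (by linarith) (by linarith)) h
  have hgeom : 27 * w * ∑ t ∈ Finset.range m, (1 - b * q) ^ t ≤ 108 * (s * w) * (m / k) := by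
    -- Hence the geometric series is at most `4s(m/k)`, and `27 · 4 = 108`.
    have h1 : a ^ 2 * k / (4 * m) ≤ b * q := by
      calc a ^ 2 * k / (4 * m) = a / 2 * q := by rw [hq]; field_simp; norm_num
        _ ≤ b * q := by gcongr
    have h2 : 1 / (b * q) ≤ 1 / (a ^ 2 * k / (4 * m)) :=
      one_div_le_one_div_of_le (by positivity) h1
    have h3 : 1 / (a ^ 2 * k / (4 * m)) = 4 * s * (m / k) := by
      rw [← hws, ha]
      field_simp
    calc 27 * w * ∑ t ∈ Finset.range m, (1 - b * q) ^ t ≤ 27 * w * (4 * s * (m / k)) := by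
          have := sum_pow_one_sub_le hbq0 hbq1 m
          gcongr
          linarith
      _ = _ := by ring
  calc mean μ (voterCost r s v)
      ≤ mean μ (fun T => ∑ t ∈ Finset.range m, max ((s : ℝ) - (topSet r v t ∩ T).card) 0) :=
        mean_mono fun T hT => voterCost_le_sum_max r v (hcard T hT)
    _ ≤ ∑ t ∈ Finset.range m,
        (3 * max ((s : ℝ) - ∑ c ∈ topSet r v t, y c) 0 + 27 * w * (1 - b * q) ^ t) := by
      rw [mean_sum]
      exact Finset.sum_le_sum hterm
    _ ≤ _ := by
      rw [Finset.sum_add_distrib, ← Finset.mul_sum, ← Finset.mul_sum]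
      exact add_le_add (mul_le_mul_of_nonneg_left (sum_max_le_voter_lp_cost r hsk hx v)
        (by norm_num)) hgeom

theorem expectedScore_le (r : Profile n m) {μ : PMF (Finset (Fin m))} (hs : 4 ≤ s) (hsk : s ≤ k)
    (hkm : k ≤ m) (hwk : 2 * √s ≤ k) (hμ : IsOutputLaw r s hkm μ) :
    expectedScore r s μ ≤ 3 * opt r k s + 108 * (s * √s) * (m / k) := by
  obtain ⟨y, ν, ⟨x, hx, hopt⟩, hν, rfl⟩ := hμ
  have hv := fun v => mean_voterCost_le r v hs hsk hkm hwk hx hν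
  set B : ℝ := 108 * (s * √s) * (m / k) with hB
  have hB0 : 0 ≤ B := by positivity
  have h1 : expectedScore r s (ν.bind (completeUniformly hkm)) =
      1 / (n : ℝ) * ∑ v, mean (ν.bind (completeUniformly hkm)) (voterCost r s v) := by
    rw [← mean_sum, ← mean_const_mul]
    rfl
  have h2 : ∑ v, mean (ν.bind (completeUniformly hkm)) (voterCost r s v) ≤
      3 * lpObjective r k s x + n * B := by
    refine (Finset.sum_le_sum fun v _ => hv v).trans (le_of_eq ?_)
    rw [Finset.sum_add_distrib, ← Finset.mul_sum]
    simp [lpObjective]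
  -- An inequality, since for `n = 0` the left side is `0`.
  have h3 : 1 / (n : ℝ) * (n * B) ≤ B := by
    rw [← mul_assoc]
    refine mul_le_of_le_one_left hB0 ?_
    rw [one_div_mul_eq_div]
    exact div_self_le_one _
  have h4 := lpObjective_le_opt r hsk hkm hopt
  calc _ ≤ 1 / (n : ℝ) * (3 * lpObjective r k s x + n * B) := by
        rw [h1]
        exact mul_le_mul_of_nonneg_left h2 (by positivity)
    _ = 3 * (1 / (n : ℝ) * lpObjective r k s x) + 1 / (n : ℝ) * (n * B) := by ring
    _ ≤ _ := by linarith

theorem card_of_mem_support_isOutputLaw (r : Profile n m) {hkm : k ≤ m}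
    {μ : PMF (Finset (Fin m))} (hμ : IsOutputLaw r s hkm μ) : ∀ T ∈ μ.support, T.card = k := by
  obtain ⟨y, ν, ⟨x, hx, -⟩, hν, rfl⟩ := hμ
  intro T hT
  obtain ⟨T₁, hT₁, hT⟩ := (PMF.mem_support_bind_iff _ _ _).1 hT
  exact card_of_mem_support_completeUniformly hkm
    (card_le_of_mem_support (by positivity) hx.sum_y hν hT₁).1 hT

theorem exists_isOutputLaw (r : Profile n m) (hs : 1 ≤ s) (hsk : s ≤ k) (hkm : k ≤ m) :
    ∃ μ, IsOutputLaw r s hkm μ := by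
  obtain ⟨y, hy⟩ := exists_isLPOptimal r hsk hkm
  obtain ⟨x, hx, -⟩ := id hy
  have h1 : 1 ≤ √(s : ℝ) := one_le_sqrt.2 (by exact_mod_cast hs)
  have h2 : 1 / √(s : ℝ) ≤ 1 := div_le_one_of_le₀ h1 (by positivity)
  have h3 : 0 ≤ 1 / √(s : ℝ) := by positivity
  obtain ⟨ν, hν⟩ := exists_dependentRounding (fun j => (1 - 1 / √(s : ℝ)) * y j) fun c =>
    ⟨mul_nonneg (by linarith) (hx.y_mem c).1,
      mul_le_one₀ (by linarith) (hx.y_mem c).1 (hx.y_mem c).2⟩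
  exact ⟨_, y, ν, hy, hν, rfl⟩

end

end SBorda

/-- Asymptotic hypotheses are read with absolute constants: there is `N` such that the bound holds
whenever `s ≥ N`, `k ≥ N s^{3/2}` and `m ≥ N k`, and the constant `A` in the `O(·)` is absolute. -/
theorem mainTheorem5 :
    ∃ A N : ℝ, 0 < A ∧ 0 < N ∧
      ∀ (n m k s : ℕ) (r : SBorda.Profile n m) (hkm : k ≤ m),
        N ≤ (s : ℝ) → N * (s : ℝ) ^ (3 / 2 : ℝ) ≤ (k : ℝ) → N * (k : ℝ) ≤ (m : ℝ) →
        (∃ μ : PMF (Finset (Fin m)), SBorda.IsOutputLaw r s hkm μ) ∧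
        ∀ μ : PMF (Finset (Fin m)), SBorda.IsOutputLaw r s hkm μ →
          (∀ T ∈ μ.support, T.card = k) ∧
          SBorda.expectedScore r s μ ≤
            3 * SBorda.opt r k s +
              A * ((s : ℝ) ^ (3 / 2 : ℝ) * Real.log s) * (((m : ℝ) + 1) / ((k : ℝ) + 1)) := by
  -- `s ≥ 4` gives `√s ≥ 2` and `log s ≥ 1`; `216 = 2 · 108`, the 2 coming from `m/k ≤
  -- 2(m+1)/(k+1)`.
  refine ⟨216, 4, by norm_num, by norm_num, fun n m k s r hkm hs hk _ => ?_⟩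
  have hpow : (s : ℝ) ^ (3 / 2 : ℝ) = s * √s := by
    rw [Real.sqrt_eq_rpow, show (3 / 2 : ℝ) = 1 + 1 / 2 by norm_num,
      Real.rpow_add (by linarith), Real.rpow_one]
  rw [hpow] at hk ⊢
  have hw : 2 ≤ √(s : ℝ) := Real.le_sqrt_of_sq_le (by linarith)
  have hs4 : 4 ≤ s := by exact_mod_cast hs
  have hsk' : (s : ℝ) ≤ k := by nlinarith
  have hsk : s ≤ k := by exact_mod_cast hsk'
  have hwk : 2 * √(s : ℝ) ≤ k := by nlinarith
  refine ⟨SBorda.exists_isOutputLaw r (by omega) hsk hkm, fun μ hμ =>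
    ⟨SBorda.card_of_mem_support_isOutputLaw r hμ, ?_⟩⟩
  refine (SBorda.expectedScore_le r hs4 hsk hkm hwk hμ).trans (add_le_add le_rfl ?_)
  have hlog : 1 ≤ Real.log s := by
    rw [Real.le_log_iff_exp_le (by linarith)]
    linarith [Real.exp_one_lt_d9]
  have hk0 : (1 : ℝ) ≤ k := by linarith
  have hdiv : (m : ℝ) / k ≤ 2 * ((m + 1) / (k + 1)) := by
    rw [← mul_div_assoc, div_le_div_iff₀ (by linarith) (by linarith)]
    nlinarith [Nat.cast_nonneg (α := ℝ) m]
  calc 108 * (s * √(s : ℝ)) * ((m : ℝ) / k)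
      ≤ 108 * (s * √(s : ℝ) * Real.log s) * (2 * ((m + 1) / (k + 1))) := by
        have : s * √(s : ℝ) ≤ s * √(s : ℝ) * Real.log s :=
          le_mul_of_one_le_right (by positivity) hlog
        gcongr ?_ * ?_
        linarith
    _ = _ := by ring
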